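/- A dynamic graph consists of a finite simple underlying graph $G=(V,E)$ with $n=|V|$ nodes and $m=|E|$ edges and, for each time $t\in\mathbb N$, a set $\mathcal E(t)\subseteq E$ of edges present at time $t$. The nodes carry pairwise distinct labels $\mathrm{id}(v)\in\mathbb N$, and at each node $v$ of degree $\delta(v)$ in $G$ the incident edges of $G$ carry distinct port numbers $1,\dots,\delta(v)$. For $T\ge 1$ the dynamic graph is $T$-interval-connected if for every $t\in\mathbb N$ the graph $\bigl(V,\bigcap_{i=t}^{t+T-1}\mathcal E(i)\bigr)$ is connected. A single agent starts at an arbitrary node at time $0$. At each time $t$, being at node $v$, it receives $\mathrm{id}(v)$, $\delta(v)$, the set of ports at $v$ whose edges are present at time $t$, and the port at $v$ through which it arrived (none at time $0$); in the model $KT_1$, but not in $KT_0$, it also receives the label of each node that is adjacent to $v$ at time $t$ together with the corresponding port at $v$. As a function of everything it has received so far, a deterministic algorithm either terminates or selects one of the available ports, through which the agent moves to the neighbour where it is at time $t+1$. The algorithm explores a dynamic graph if, from every starting node, the agent visits all nodes. For $k\in\{0,1\}$, $n\ge 3$ and $n\le m\le\binom n2$, let $\psi_k(n,m)$ be the minimum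 $T\ge 1$ for which there is a deterministic algorithm that, in the model $KT_k$, explores every $T$-interval-connected dynamic graph with $n$ nodes and $m$ edges, and let $\psi_k(n)=\max\{\psi_k(n,m) : n\le m\le\binom n2\}$. Then, for each $k\in\{0,1\}$, these minima exist and $\psi_k(n)=\Theta(n^2)$ as $n\to\infty$. -/

import Mathlib

open Filter Asymptotics

namespace DynExplore

/-- The two visibility models `KT_0` and `KT_1`. -/
inductive Visibility where
  | kt_zero
  | kt_one

/-- A dynamic graph on the node set `V`: an underlying simple graph `G`, the snapshot at each time
`t` (a spanning subgraph of `G`), pairwise distinct node labels, and, at every node `v`, port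
numbers that put the neighbours of `v` in `G` in bijection with `1, …, δ(v)`. -/
structure DynGraph (V : Type) where
  /-- the underlying graph -/
  G : SimpleGraph V
  /-- the snapshot at each time -/
  snap : ℕ → SimpleGraph V
  snap_le : ∀ t, snap t ≤ G
  /-- node labels -/
  label : V → ℕ
  label_injective : Function.Injective label
  /-- `port v u` is the port number at `v` of the edge `{v, u}`; only meaningful for neighbours -/
  port : V → V → ℕ
  port_bijOn : ∀ v, Set.BijOn (port v) (G.neighborSet v) (Set.Icc 1 (G.neighborSet v).ncard)

/-- In every window of `T` consecutive times, the edges that are present throughout the window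
connect all nodes. -/
def DynGraph.IntervalConnected {V : Type} (D : DynGraph V) (T : ℕ) : Prop :=
  ∀ t : ℕ, (⨅ i : Fin T, D.snap (t + i)).Connected

/-- What the agent perceives at one time step. -/
structure Observation where
  /-- label of the current node -/
  label : ℕ
  /-- degree of the current node in the underlying graph -/
  degree : ℕ
  /-- ports of the current node that are available now -/
  avail : Set ℕ
  /-- incoming port (`none` at time `0`) -/
  inPort : Option ℕ
  /-- `KT_1` only: the pairs (label, port) of the currently adjacent nodes; empty in `KT_0` -/
  nbrs : Set (ℕ × ℕ)

/-- The observation made at node `v` at time `t`, having arrived through port `q`. -/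
noncomputable def DynGraph.observe {V : Type} (D : DynGraph V) (k : Visibility) (t : ℕ) (v : V)
    (q : Option ℕ) : Observation where
  label := D.label v
  degree := (D.G.neighborSet v).ncard
  avail := {p | ∃ u, (D.snap t).Adj v u ∧ D.port v u = p}
  inPort := q
  nbrs := match k with
    | .kt_zero => ∅
    | .kt_one => {x | ∃ u, (D.snap t).Adj v u ∧ x = (D.label u, D.port v u)}

/-- A deterministic algorithm: from the past observations (most recent first) and the current one,
it either terminates (`none`) or selects a currently available port. -/
abbrev Algorithm : Type :=
  (past : List Observation) → (cur : Observation) → Option {p : ℕ // p ∈ cur.avail}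

/-- State of the agent that has not terminated: position, incoming port and memory. -/
structure Config (V : Type) where
  pos : V
  inPort : Option ℕ
  past : List Observation

/-- One time step; `none` means that the agent terminates. The chosen available port `p` determines
the neighbour to which the agent moves, since ports at a node are distinct. -/
noncomputable def DynGraph.step {V : Type} (D : DynGraph V) (k : Visibility) (A : Algorithm)
    (t : ℕ) (c : Config V) : Option (Config V) :=
  (A c.past (D.observe k t c.pos c.inPort)).map
    fun (p : {p : ℕ // ∃ u, (D.snap t).Adj c.pos u ∧ D.port c.pos u = p}) =>
      { pos := p.2.choose
        inPort := some (D.port p.2.choose c.pos)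
        past := D.observe k t c.pos c.inPort :: c.past }

/-- The state at each time of the agent that runs `A` from node `s`; `none` after termination. -/
noncomputable def DynGraph.run {V : Type} (D : DynGraph V) (k : Visibility) (A : Algorithm)
    (s : V) : ℕ → Option (Config V)
  | 0 => some { pos := s, inPort := none, past := [] }
  | t + 1 => (D.run k A s t).bind (D.step k A t)

/-- The agent that runs `A` from node `s` visits every node. -/
def DynGraph.Explores {V : Type} (D : DynGraph V) (k : Visibility) (A : Algorithm) (s : V) : Prop :=
  ∀ v : V, ∃ t : ℕ, ∃ c : Config V, D.run k A s t = some c ∧ c.pos = v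

/-- Some deterministic algorithm explores, from every starting node, every `T`-interval-connected
graph with `n` nodes and `m` edges. -/
def Explorable (k : Visibility) (n m T : ℕ) : Prop :=
  ∃ A : Algorithm, ∀ (V : Type) [Finite V] (D : DynGraph V),
    Nat.card V = n → D.G.edgeSet.ncard = m → D.IntervalConnected T →
      ∀ s : V, D.Explores k A s

/-- `ψ_k(n, m)`: the minimum window size that makes exploration possible. -/
noncomputable def psiEdges (k : Visibility) (n m : ℕ) : ℕ :=
  sInf {T : ℕ | 1 ≤ T ∧ Explorable k n m T}

/-- `ψ_k(n)`: the maximum of `ψ_k(n, m)` over all `m` with `n ≤ m ≤ n(n-1)/2`. -/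
noncomputable def psi (k : Visibility) (n : ℕ) : ℕ :=
  (Finset.Icc n (n.choose 2)).sup (psiEdges k n)

end DynExplore

/-!
Both models satisfy the same bounds `n ^ 2 / 576 ≤ ψ(n) ≤ n ^ 2` for large `n`: the algorithm below
ignores the labels of adjacent nodes, and the adversary below defeats algorithms that use them.

*Upper bound.* With `T = n ^ 2` the agent explores as in learning real-time search. It remembers for
ever which node each port it has used leads to, and keeps a height for every node, reset to `0` at
the multiples of `T`. At a node `v` it leaves through an available port of least value, the value
being `0` for a port never used before and otherwise the height of the node behind it; the height of
`v` becomes that value plus one. If a node `x` were never visited, then within one period the height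
of `v` would stay at most the distance from `v` to `x` in the graph `H` of edges present throughout
the period, because the first edge of a shortest `H`-path to `x` is always available. While no new
port is used, the sum of all heights minus the height of the current node grows by exactly one per
step, so after `T - 1 > n (n - 1)` steps the sum exceeds `n (n - 1)`, although each height is at
most the distance to `x` and hence at most `n - 1` (`exists_pos_eq_of_heights`). Hence every period
uses up a new pair (node, neighbour), and there are finitely many.

*Lower bound.* The underlying graph is complete and one node `u` is never visited. Time is cut into
rounds of `q` steps, with `n` about `9 q`; nodes are hidden by and by, and a snapshot lacks exactly
the edges between the agent and the hidden nodes. Hiding happens in batches: batch `b` hides one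
further node `W b c` at the start of each round `c` in `[b q, (b + 2) q)`, chosen among the nodes
not visited in the round before, and releases all of them together at round `(b + 2) q`. The edge
from `W b c` to `W b (c + 1)` is not missing around that time: before round `c` neither is hidden,
during round `c` the agent visits neither, and later both are hidden until both are released. So in
every window of at most `q ^ 2` steps each batch forms a path ending at a node that is not hidden
during the window. Those nodes form a clique, and `u` is joined to the node hidden throughout the
window by the later batch that is active when it starts. This gives connectivity
(`connected_iInf_shownGraph`). The overlap of consecutive batches is what allows a batch to be
released without breaking the windows around that moment. As the snapshot depends on the agent's
past only, the adaptive adversary is turned into one fixed dynamic graph by a fixed-point argument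
(`DynGraph.exists_adaptive`).
-/

namespace DynExplore

/-! ### The exploration algorithm -/

/-- The potential argument behind the upper bound, stated for a bare sequence of positions. A step
from `pos t` to `w` has value `height t w` if it was made before and `0` otherwise; the agent makes
a step of least value among those possible, and the height of the node it leaves becomes that value
plus one. -/
theorem exists_pos_eq_of_heights {V : Type} [Fintype V] [DecidableEq V] {T : ℕ}
    (hV : 2 ≤ Fintype.card V) (hT : Fintype.card V ^ 2 ≤ T) (snap : ℕ → SimpleGraph V)
    (hconn : ∀ t : ℕ, (⨅ i : Fin T, snap (t + i)).Connected) (pos : ℕ → V) (used : ℕ → Finset (V × V))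
    (hused : ∀ t, used t = (Finset.range t).image fun s => (pos s, pos (s + 1)))
    (height : ℕ → V → ℕ) (value : ℕ → V → ℕ)
    (hvalue : ∀ t w, value t w = if (pos t, w) ∈ used t then height t w else 0)
    (hreset : ∀ t, T ∣ t → height t = 0)
    (hstep : ∀ t, ¬ T ∣ t + 1 →
      height (t + 1) = Function.update (height t) (pos t) (value t (pos (t + 1)) + 1))
    (hmove : ∀ t, (snap t).Adj (pos t) (pos (t + 1)))
    (hmin : ∀ t w, (snap t).Adj (pos t) w → value t (pos (t + 1)) ≤ value t w) (x : V) :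
    ∃ t, pos t = x := by
  by_contra! hx
  have mono : ∀ {s t}, s ≤ t → used s ⊆ used t := by
    intro s t hst
    rw [hused, hused]
    exact Finset.image_subset_image (Finset.range_mono hst)
  have hTpos : 0 < T := lt_of_lt_of_le (by positivity) hT
  -- Every period of `T` steps contains a step never made before.
  have grow : ∀ i, (used (i * T)).card < (used ((i + 1) * T)).card := by
    intro i
    by_contra! hle
    have heq : used (i * T) = used ((i + 1) * T) :=
      Finset.eq_of_subset_of_card_le (mono (Nat.mul_le_mul_right _ (Nat.le_succ i))) hle
    set H := ⨅ j : Fin T, snap (i * T + j) with hH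
    have hHc : H.Connected := hconn _
    have key : ∀ τ, τ < T → (∀ v, height (i * T + τ) v ≤ H.dist v x) ∧
        ∑ v, height (i * T + τ) v = height (i * T + τ) (pos (i * T + τ)) + τ := by
      intro τ
      induction τ with
      | zero =>
        intro _
        have := hreset (i * T) (Dvd.intro_left i rfl)
        simp [this]
      | succ τ ih =>
        intro hτ
        obtain ⟨ih1, ih2⟩ := ih (by omega)
        set t := i * T + τ with ht
        have hnd : ¬ T ∣ t + 1 := by
          rw [ht, add_assoc, Nat.dvd_add_right (Dvd.intro_left i rfl)]
          exact Nat.not_dvd_of_pos_of_lt (by omega) hτ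
        have hst := hstep t hnd
        have hmem : (pos t, pos (t + 1)) ∈ used t := by
          apply mono (Nat.le_add_right (i * T) τ)
          rw [heq, hused]
          refine Finset.mem_image.2 ⟨t, ?_, rfl⟩
          rw [Finset.mem_range, ht, add_mul]
          omega
        have hval : value t (pos (t + 1)) = height t (pos (t + 1)) := by
          rw [hvalue, if_pos hmem]
        rw [← add_assoc, ← ht]
        constructor
        · intro v
          rw [hst]
          by_cases hv : v = pos t
          · subst hv
            rw [Function.update_self]
            obtain ⟨p, hp⟩ := (hHc (pos t) x).exists_walk_length_eq_dist
            -- The first edge of a shortest path to `x` is present now, so it bounds the value.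
            cases p with
            | nil => exact absurd rfl (hx t)
            | @cons _ w _ hadj p' =>
              have h1 : (snap t).Adj (pos t) w := by
                have h2 := (SimpleGraph.iInf_adj.1 hadj).1 ⟨τ, by omega⟩
                simpa [ht] using h2
              have h3 : value t w ≤ H.dist w x := by
                rw [hvalue]
                split_ifs
                · exact ih1 w
                · exact Nat.zero_le _
              have h4 := SimpleGraph.dist_le p'
              have h5 := hmin t w h1
              rw [← hp, SimpleGraph.Walk.length_cons]
              omega
          · rw [Function.update_of_ne hv]
            exact ih1 v
        -- The height of `pos t` is replaced by that of `pos (t + 1)` plus one, so the sum of heights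
        -- minus the height of the current node increases by one.
        · have h6 := Finset.sum_update_of_mem (Finset.mem_univ (pos t)) (height t)
            (value t (pos (t + 1)) + 1)
          have h7 := Finset.sum_eq_add_sum_sdiff_singleton_of_mem (Finset.mem_univ (pos t)) (height t)
          have h8 : height (t + 1) (pos (t + 1)) = height t (pos (t + 1)) := by
            rw [hst]
            exact Function.update_of_ne (hmove t).ne' _ _
          rw [h8, hst, h6, hval]
          omega
    obtain ⟨k1, k2⟩ := key (T - 1) (by omega)
    set t := i * T + (T - 1)
    have hb : ∑ v, height t v ≤ ∑ _v : V, (Fintype.card V - 1) := by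
      refine Finset.sum_le_sum fun v _ => (k1 v).trans ?_
      obtain ⟨p, hp, hpl⟩ := hHc.exists_path_of_dist v x
      have := hp.length_lt
      omega
    rw [Finset.sum_const, Finset.card_univ, smul_eq_mul] at hb
    have : Fintype.card V * (Fintype.card V - 1) + Fintype.card V = Fintype.card V ^ 2 := by
      obtain ⟨m, hm⟩ : ∃ m, Fintype.card V = m + 1 := ⟨Fintype.card V - 1, by omega⟩
      rw [hm, Nat.add_sub_cancel]
      ring
    omega
  have hlow : ∀ i, i ≤ (used (i * T)).card := by
    intro i
    induction i with
    | zero => exact Nat.zero_le _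
    | succ i ih => exact Nat.succ_le_of_lt (ih.trans_lt (grow i))
  have h1 := hlow (Fintype.card (V × V) + 1)
  have h2 := Finset.card_le_univ (used ((Fintype.card (V × V) + 1) * T))
  omega

/-- What the exploring agent remembers. Nodes are known by their labels. -/
structure Memory where
  /-- the current time -/
  time : ℕ
  /-- the node left last, with the port used; the node behind that port is only learnt from the next
  observation -/
  lastExit : Option (ℕ × ℕ)
  /-- `target a p` is the node behind port `p` of node `a`, if that port was used -/
  target : ℕ → ℕ → Option ℕ
  /-- the heights of the nodes -/
  height : ℕ → ℕ

namespace Memory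

/-- The memory at time `0`. -/
def init : Memory := ⟨0, none, fun _ _ => none, 0⟩

/-- The known targets of ports once the agent has seen that it arrived at node `l`. -/
def learn (M : Memory) (l : ℕ) : ℕ → ℕ → Option ℕ :=
  fun a p => if M.lastExit = some (a, p) then some l else M.target a p

/-- The value of leaving the observed node through port `p`: the height of the node behind it, or `0`
if that node is unknown. -/
def value (M : Memory) (o : Observation) (p : ℕ) : ℕ :=
  (M.learn o.label o.label p).elim 0 M.height

open Classical in
/-- An available port of least value (`0`, which is no port, if none is available). -/
noncomputable def exit (M : Memory) (o : Observation) : ℕ :=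
  if h : o.avail.Nonempty then Function.argminOn (M.value o) o.avail h else 0

theorem exit_mem (M : Memory) (o : Observation) (h : o.avail.Nonempty) : M.exit o ∈ o.avail := by
  rw [exit, dif_pos h]
  exact Function.argminOn_mem _ _ _

theorem value_exit_le (M : Memory) (o : Observation) {p : ℕ} (hp : p ∈ o.avail) :
    M.value o (M.exit o) ≤ M.value o p := by
  rw [exit, dif_pos ⟨p, hp⟩]
  exact Function.argminOn_le _ _ hp

/-- The memory after the observation `o` and the move it causes; heights are reset at the multiples
of `T`. -/
noncomputable def next (T : ℕ) (M : Memory) (o : Observation) : Memory where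
  time := M.time + 1
  lastExit := some (o.label, M.exit o)
  target := M.learn o.label
  height := if T ∣ M.time + 1 then 0 else
    Function.update M.height o.label (M.value o (M.exit o) + 1)

/-- The memory that results from the past observations, most recent first. -/
noncomputable def ofPast (T : ℕ) (past : List Observation) : Memory :=
  past.foldr (fun o M => M.next T o) init

end Memory

open Classical in
/-- The algorithm that always leaves through an available port of least value. -/
noncomputable def explorer (T : ℕ) : Algorithm := fun past cur =>
  if h : cur.avail.Nonempty then
    some ⟨(Memory.ofPast T past).exit cur, Memory.exit_mem _ _ h⟩
  else none

theorem exists_step_explorer {V : Type} (D : DynGraph V) (k : Visibility) (T t : ℕ) (c : Config V)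
    (h : ∃ u, (D.snap t).Adj c.pos u) :
    ∃ c', D.step k (explorer T) t c = some c' ∧ (D.snap t).Adj c.pos c'.pos ∧
      D.port c.pos c'.pos = (Memory.ofPast T c.past).exit (D.observe k t c.pos c.inPort) ∧
      c'.past = D.observe k t c.pos c.inPort :: c.past := by
  obtain ⟨u, hu⟩ := h
  have hne : (D.observe k t c.pos c.inPort).avail.Nonempty := ⟨_, u, hu, rfl⟩
  have hA : explorer T c.past (D.observe k t c.pos c.inPort) = some
      ⟨(Memory.ofPast T c.past).exit (D.observe k t c.pos c.inPort), Memory.exit_mem _ _ hne⟩ :=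
    dif_pos hne
  have hex : ∃ u, (D.snap t).Adj c.pos u ∧
      D.port c.pos u = (Memory.ofPast T c.past).exit (D.observe k t c.pos c.inPort) :=
    Memory.exit_mem _ _ hne
  refine ⟨⟨hex.choose, some (D.port hex.choose c.pos), D.observe k t c.pos c.inPort :: c.past⟩,
    ?_, hex.choose_spec.1, hex.choose_spec.2, rfl⟩
  unfold DynGraph.step
  rw [hA]
  rfl

theorem exists_trajectory_explorer {V : Type} (D : DynGraph V) (k : Visibility) (T : ℕ) (s : V)
    (h : ∀ t v, ∃ u, (D.snap t).Adj v u) :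
    ∃ c : ℕ → Config V, c 0 = ⟨s, none, []⟩ ∧ (∀ t, D.run k (explorer T) s t = some (c t)) ∧
      ∀ t, (D.snap t).Adj (c t).pos (c (t + 1)).pos ∧
        D.port (c t).pos (c (t + 1)).pos =
          (Memory.ofPast T (c t).past).exit (D.observe k t (c t).pos (c t).inPort) ∧
        (c (t + 1)).past = D.observe k t (c t).pos (c t).inPort :: (c t).past := by
  choose f hf using fun t c => exists_step_explorer D k T t c (h t c.pos)
  refine ⟨fun t => Nat.rec ⟨s, none, []⟩ (fun t c => f t c) t, rfl, ?_, fun t => (hf t _).2⟩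
  intro t
  induction t with
  | zero => rfl
  | succ t ih => simp only [DynGraph.run, ih, Option.bind_some, (hf t _).1]

theorem DynGraph.port_inj {V : Type} (D : DynGraph V) {v w w' : V} (h : D.G.Adj v w)
    (h' : D.G.Adj v w') (he : D.port v w = D.port v w') : w = w' :=
  (D.port_bijOn v).injOn h h' he

theorem explores_explorer {V : Type} [Finite V] (D : DynGraph V) (k : Visibility) {T : ℕ}
    (hV : 2 ≤ Nat.card V) (hT : Nat.card V ^ 2 ≤ T) (hD : D.IntervalConnected T) (s : V) :
    D.Explores k (explorer T) s := by
  classical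
  have := Fintype.ofFinite V
  rw [Nat.card_eq_fintype_card] at hV hT
  have hTpos : 0 < T := lt_of_lt_of_le (by positivity) hT
  have : Nontrivial V := Fintype.one_lt_card_iff_nontrivial.1 hV
  have hav : ∀ t v, ∃ u, (D.snap t).Adj v u := by
    intro t v
    obtain ⟨u, hu⟩ := (hD t).preconnected.exists_adj_of_nontrivial v
    exact ⟨u, by simpa using (SimpleGraph.iInf_adj.1 hu).1 ⟨0, hTpos⟩⟩
  obtain ⟨c, hc0, hrun, hc⟩ := exists_trajectory_explorer D k T s hav
  choose hadj hport hpast using hc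
  set pos := fun t => (c t).pos with hpos
  set M := fun t => Memory.ofPast T (c t).past with hM
  set o := fun t => D.observe k t (c t).pos (c t).inPort with ho
  have hM0 : M 0 = Memory.init := by simp [hM, hc0, Memory.ofPast]
  have hMs : ∀ t, M (t + 1) = (M t).next T (o t) := by
    intro t
    simp [hM, hpast, Memory.ofPast, ho]
  have hlab : ∀ t, (o t).label = D.label (pos t) := fun t => rfl
  have hGadj : ∀ t, D.G.Adj (pos t) (pos (t + 1)) := fun t => D.snap_le t (hadj t)
  set used : ℕ → Finset (V × V) :=
    fun t => (Finset.range t).image fun s => (pos s, pos (s + 1)) with hused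
  have htime : ∀ t, (M t).time = t := by
    intro t
    induction t with
    | zero => rw [hM0]; rfl
    | succ t ih => rw [hMs, Memory.next, ih]
  -- The known ports are exactly those of the steps made so far, and their targets are correct.
  have hlearn : ∀ t v w, D.G.Adj v w → (M t).learn (D.label (pos t)) (D.label v) (D.port v w) =
      if (v, w) ∈ used t then some (D.label w) else none := by
    intro t
    induction t with
    | zero =>
      intro v w _
      rw [hM0]
      simp [hused, Memory.learn, Memory.init]
    | succ t ih =>
      intro v w hvw
      have h1 : (M (t + 1)).learn (D.label (pos (t + 1))) (D.label v) (D.port v w) =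
          if some (D.label (pos t), D.port (pos t) (pos (t + 1))) = some (D.label v, D.port v w)
          then some (D.label (pos (t + 1)))
          else (M t).learn (D.label (pos t)) (D.label v) (D.port v w) := by
        rw [hMs, hport]
        rfl
      rw [h1, ih v w hvw]
      have h2 : (some (D.label (pos t), D.port (pos t) (pos (t + 1))) =
          some (D.label v, D.port v w)) ↔ (pos t, pos (t + 1)) = (v, w) := by
        constructor
        · intro h
          obtain ⟨h3, h4⟩ := Prod.mk.inj (Option.some.inj h)
          have h5 := D.label_injective h3
          subst h5
          rw [D.port_inj (hGadj t) hvw h4]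
        · intro h
          obtain ⟨h3, h4⟩ := Prod.mk.inj h
          rw [h3, h4]
      have h3 : (v, w) ∈ used (t + 1) ↔ (pos t, pos (t + 1)) = (v, w) ∨ (v, w) ∈ used t := by
        simp only [hused, Finset.range_add_one, Finset.image_insert, Finset.mem_insert]
        rw [eq_comm]
      by_cases h4 : (pos t, pos (t + 1)) = (v, w)
      · rw [if_pos (h2.2 h4), if_pos (h3.2 (Or.inl h4)), (Prod.mk.inj h4).2]
      · rw [if_neg (fun h => h4 (h2.1 h))]
        simp only [h3, h4, false_or]
  have hval : ∀ t w, (D.snap t).Adj (pos t) w → (M t).value (o t) (D.port (pos t) w) =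
      if (pos t, w) ∈ used t then (M t).height (D.label w) else 0 := by
    intro t w hw
    rw [Memory.value, hlab, hlearn t _ _ (D.snap_le t hw)]
    split_ifs <;> rfl
  intro x
  obtain ⟨t, ht⟩ := exists_pos_eq_of_heights hV hT D.snap hD pos used (fun _ => rfl)
    (fun t v => (M t).height (D.label v))
    (fun t w => if (pos t, w) ∈ used t then (M t).height (D.label w) else 0) (fun _ _ => rfl)
    (by
      intro t ht
      funext v
      cases t with
      | zero => simp [hM0, Memory.init]
      | succ t => simp [hMs, Memory.next, htime, ht])
    (by
      intro t ht
      funext v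
      have h1 := hval t (pos (t + 1)) (hadj t)
      simp only [← h1]
      rw [hMs, Memory.next, htime, hport]
      simp only [if_neg ht]
      by_cases hv : v = pos t
      · subst hv
        rw [Function.update_self, hlab, Function.update_self]
      · rw [Function.update_of_ne hv, hlab,
          Function.update_of_ne (D.label_injective.ne hv)])
    hadj
    (by
      intro t w hw
      have h1 := hval t (pos (t + 1)) (hadj t)
      simp only [← hval t w hw, ← h1]
      rw [hport]
      exact (M t).value_exit_le (o t) ⟨w, hw, rfl⟩)
    x
  exact ⟨t, c t, hrun t, ht⟩

theorem explorable_sq (k : Visibility) {n : ℕ} (hn : 2 ≤ n) (m : ℕ) : Explorable k n m (n ^ 2) := by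
  refine ⟨explorer (n ^ 2), fun V _ D hV _ hD s => ?_⟩
  subst hV
  exact explores_explorer D k hn le_rfl hD s

/-! ### Adaptive adversaries -/

/-- A map on sequences whose value at time `t` depends on the argument at times before `t` only has a
fixed point. -/
theorem exists_eq_of_causal {V : Type} [Nonempty V] (f : (ℕ → V) → ℕ → V)
    (hf : ∀ p p' t, (∀ s < t, p s = p' s) → f p t = f p' t) : ∃ p, f p = p := by
  obtain ⟨v⟩ := ‹Nonempty V›
  have h : ∀ t i j, t < i → t < j → f^[i] (fun _ => v) t = f^[j] (fun _ => v) t := by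
    intro t
    induction t using Nat.strong_induction_on with
    | _ t ih =>
      intro i j hi hj
      obtain ⟨i, rfl⟩ : ∃ i', i = i' + 1 := ⟨i - 1, by omega⟩
      obtain ⟨j, rfl⟩ : ∃ j', j = j' + 1 := ⟨j - 1, by omega⟩
      rw [Function.iterate_succ_apply', Function.iterate_succ_apply']
      exact hf _ _ _ fun s hs => ih s hs _ _ (by omega) (by omega)
  refine ⟨fun t => f^[t + 1] (fun _ => v) t, ?_⟩
  funext t
  rw [Function.iterate_succ_apply']
  exact hf _ _ _ fun s hs => h s _ _ (by omega) (by omega)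

theorem exists_dynGraph_top (V : Type) [Finite V] : ∃ D : DynGraph V, D.G = ⊤ := by
  obtain ⟨n, ⟨e⟩⟩ := Finite.exists_equiv_fin V
  have h : ∀ v : V, ∃ f : V → ℕ, Set.BijOn f ((⊤ : SimpleGraph V).neighborSet v)
      (Set.Icc 1 ((⊤ : SimpleGraph V).neighborSet v).ncard) := by
    intro v
    apply Set.Finite.exists_bijOn_of_encard_eq (Set.toFinite _)
    rw [← (Set.toFinite _).cast_ncard_eq, ← (Set.finite_Icc _ _).cast_ncard_eq]
    simp [Set.ncard_eq_toFinset_card']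
  choose f hf using h
  exact ⟨{  G := ⊤
            snap := fun _ => ⊤
            snap_le := fun _ => le_rfl
            label := fun v => e v
            label_injective := Fin.val_injective.comp e.injective
            port := f
            port_bijOn := hf }, rfl⟩

/-- The dynamic graph `D` with its snapshots replaced by `S`. -/
def DynGraph.withSnap {V : Type} (D : DynGraph V) (S : ℕ → SimpleGraph V) (hS : ∀ t, S t ≤ D.G) :
    DynGraph V := { D with snap := S, snap_le := hS }

section Adaptive

variable {V : Type} (D : DynGraph V) (k : Visibility) (A : Algorithm) (s : V)

theorem DynGraph.step_adj {t : ℕ} {c c' : Config V} (h : D.step k A t c = some c') :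
    (D.snap t).Adj c.pos c'.pos := by
  obtain ⟨p, -, rfl⟩ := Option.map_eq_some_iff.1 h
  exact p.2.choose_spec.1

/-- The position of the agent at each time; after termination, its last position. -/
noncomputable def DynGraph.position : ℕ → V
  | 0 => s
  | t + 1 => (D.run k A s (t + 1)).elim (DynGraph.position t) Config.pos

theorem DynGraph.position_eq {t : ℕ} {c : Config V} (h : D.run k A s t = some c) :
    D.position k A s t = c.pos := by
  cases t with
  | zero => obtain rfl := Option.some.inj h; rfl
  | succ t => rw [DynGraph.position, h]; rfl

theorem DynGraph.position_succ (t : ℕ) :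
    D.position k A s (t + 1) = D.position k A s t ∨
      (D.snap t).Adj (D.position k A s t) (D.position k A s (t + 1)) := by
  cases h : D.run k A s (t + 1) with
  | none => left; rw [DynGraph.position, h]; rfl
  | some c' =>
    right
    obtain ⟨c, hc, hc'⟩ := Option.bind_eq_some_iff.1 h
    rw [D.position_eq k A s h, D.position_eq k A s hc]
    exact D.step_adj k A hc'

variable {D}

theorem DynGraph.run_withSnap_congr {S S' : ℕ → SimpleGraph V} (hS : ∀ t, S t ≤ D.G)
    (hS' : ∀ t, S' t ≤ D.G) {t : ℕ} (h : ∀ i < t, S i = S' i) :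
    (D.withSnap S hS).run k A s t = (D.withSnap S' hS').run k A s t := by
  induction t with
  | zero => rfl
  | succ t ih =>
    have h1 : (D.withSnap S hS).step k A t = (D.withSnap S' hS').step k A t := by
      have h2 : ∀ (X Y : SimpleGraph V) (hX : X ≤ D.G) (hY : Y ≤ D.G), X = Y →
          (D.withSnap (fun _ => X) fun _ => hX).step k A t =
            (D.withSnap (fun _ => Y) fun _ => hY).step k A t := by
        rintro X _ _ _ rfl
        rfl
      exact h2 _ _ (hS t) (hS' t) (h t (Nat.lt_succ_self t))
    rw [DynGraph.run, DynGraph.run, ih fun i hi => h i (by omega), h1]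

theorem DynGraph.position_withSnap_congr {S S' : ℕ → SimpleGraph V} (hS : ∀ t, S t ≤ D.G)
    (hS' : ∀ t, S' t ≤ D.G) {t : ℕ} (h : ∀ i < t, S i = S' i) :
    (D.withSnap S hS).position k A s t = (D.withSnap S' hS').position k A s t := by
  induction t with
  | zero => rfl
  | succ t ih =>
    rw [DynGraph.position, DynGraph.position, ih fun i hi => h i (by omega),
      DynGraph.run_withSnap_congr k A s hS hS' h]

/-- An adversary may choose the snapshot at time `t` in view of the agent's positions up to time `t`:
for every such rule `F` on a complete underlying graph there is a dynamic graph whose snapshots obey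
`F` along the trajectory of `A` in that very graph. -/
theorem DynGraph.exists_adaptive (hD : D.G = ⊤) (F : ℕ → (ℕ → V) → SimpleGraph V)
    (hF : ∀ t p p', (∀ i ≤ t, p i = p' i) → F t p = F t p') :
    ∃ D' : DynGraph V, D'.G = ⊤ ∧ ∀ t, D'.snap t = F t (D'.position k A s) := by
  have hle : ∀ (p : ℕ → V) t, F t p ≤ D.G := fun p t => hD ▸ le_top
  have : Nonempty V := ⟨s⟩
  obtain ⟨p, hp⟩ := exists_eq_of_causal
    (fun p => (D.withSnap (fun t => F t p) (hle p)).position k A s) (by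
      intro p p' t h
      exact DynGraph.position_withSnap_congr k A s _ _
        fun i hi => hF i p p' fun j hj => h j (by omega))
  refine ⟨D.withSnap (fun t => F t p) (hle p), hD, fun t => ?_⟩
  rw [hp]
  rfl

end Adaptive

/-! ### The adversary of the lower bound -/

/-- The nodes hidden in round `r`: `u` always, and the nodes `W b c` of every batch `b`, from round
`c ≥ b * M` up to the end of the batch at round `(b + 2) * M`. -/
def hiddenSet {V : Type} (u : V) (W : ℕ → ℕ → V) (M r : ℕ) : Set V :=
  {x | x = u ∨ ∃ b c, b * M ≤ c ∧ c ≤ r ∧ r < (b + 2) * M ∧ x = W b c}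

/-- The complete graph without the edges between the agent's position `v` and the hidden nodes. -/
def shownGraph {V : Type} (v : V) (H : Set V) : SimpleGraph V where
  Adj x y := x ≠ y ∧ ¬(x = v ∧ y ∈ H) ∧ ¬(y = v ∧ x ∈ H)
  symm := ⟨fun _ _ h => ⟨h.1.symm, h.2.2, h.2.1⟩⟩
  loopless := ⟨fun _ h => h.1 rfl⟩

/-- The adversary's snapshots are `T`-interval-connected for `T ≤ M * q`, with rounds of `q` steps:
it suffices that the agent avoids hidden nodes, that batches whose numbers differ mod 3 (as those of
any three consecutive batches do) use disjoint sets of nodes, that a batch never repeats a node, and that the node `W b (c + 1)`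
is not visited in round `c`. -/
theorem connected_iInf_shownGraph {V : Type} {u : V} {W : ℕ → ℕ → V} {p : ℕ → V} {q M T : ℕ}
    (hq : 0 < q) (hM : 0 < M) (hT : T ≤ M * q)
    (hp : ∀ t, p t ∉ hiddenSet u W M (t / q))
    (hWu : ∀ b c, W b c ≠ u)
    (hclass : ∀ b c b' c', W b c = W b' c' → b % 3 = b' % 3)
    (hinj : ∀ b c c', b * M ≤ c → c < c' → c' ≤ (b + 2) * M → W b c' ≠ W b c)
    (hfresh : ∀ b t, b * M ≤ t / q + 1 → t / q + 1 ≤ (b + 2) * M → p t ≠ W b (t / q + 1)) (t : ℕ) :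
    (⨅ i : Fin T, shownGraph (p (t + i)) (hiddenSet u W M ((t + i) / q))).Connected := by
  set E := ⨅ i : Fin T, shownGraph (p (t + i)) (hiddenSet u W M ((t + i) / q)) with hE
  obtain ⟨a, ha⟩ : ∃ a, a = t / q := ⟨_, rfl⟩
  obtain ⟨j, hj⟩ : ∃ j, j = a / M := ⟨_, rfl⟩
  have hj1 : j * M ≤ a := hj ▸ Nat.div_mul_le_self a M
  have hj2 : a < (j + 1) * M := by
    rw [hj, mul_comm]; exact Nat.lt_mul_div_succ a hM
  -- The window meets rounds `a, …, a + M` only, and `a` lies in `[j * M, (j + 1) * M)`.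
  have hround : ∀ i : Fin T, a ≤ (t + i) / q ∧ (t + i) / q ≤ a + M := by
    intro i
    constructor
    · rw [ha]; exact Nat.div_le_div_right (Nat.le_add_right _ _)
    · have h1 : t + i ≤ t + M * q := by have := i.2; omega
      calc (t + i) / q ≤ (t + M * q) / q := Nat.div_le_div_right h1
        _ = a + M := by rw [Nat.add_mul_div_right _ _ hq, ha]
  have hadj : ∀ {x y}, x ≠ y →
      (∀ i : Fin T, p (t + i) = x → y ∉ hiddenSet u W M ((t + i) / q)) →
      (∀ i : Fin T, p (t + i) = y → x ∉ hiddenSet u W M ((t + i) / q)) → E.Adj x y := by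
    intro x y hxy h1 h2
    rw [hE, SimpleGraph.iInf_adj]
    exact ⟨fun i => ⟨hxy, fun h => h1 i h.1.symm h.2, fun h => h2 i h.1.symm h.2⟩, hxy⟩
  have hfree : ∀ {x y}, (∀ i : Fin T, x ∉ hiddenSet u W M ((t + i) / q)) →
      (∀ i : Fin T, y ∉ hiddenSet u W M ((t + i) / q)) → E.Reachable x y := by
    intro x y hx hy
    by_cases hxy : x = y
    · rw [hxy]
    · exact (hadj hxy (fun i _ => hy i) (fun i _ => hx i)).reachable
  -- Only the batches `j - 1`, `j`, `j + 1` hide nodes in these rounds, so that among the active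
  -- batches the residue mod 3 determines the batch.
  have hact : ∀ {b r}, a ≤ r → r ≤ a + M → b * M ≤ r → r < (b + 2) * M → j ≤ b + 1 ∧ b ≤ j + 1 := by
    intro b r h1 h2 h3 h4
    constructor
    · have : j * M < (b + 2) * M := by omega
      have := Nat.lt_of_mul_lt_mul_right this
      omega
    · have : b * M < (j + 2) * M := by
        rw [add_mul] at hj2 ⊢; omega
      have := Nat.lt_of_mul_lt_mul_right this
      omega
  have hmem : ∀ {b c}, j ≤ b + 1 → b ≤ j + 1 → b * M ≤ c → c ≤ (b + 2) * M → ∀ i : Fin T,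
      W b c ∈ hiddenSet u W M ((t + i) / q) → c ≤ (t + i) / q ∧ (t + i) / q < (b + 2) * M := by
    intro b c hb1 hb2 hc1 hc2 i hin
    rcases hin with h | ⟨b', c', h1, h2, h3, h4⟩
    · exact absurd h (hWu b c)
    · have h5 := hact (hround i).1 (hround i).2 (h1.trans h2) h3
      have h6 := hclass _ _ _ _ h4
      obtain rfl : b = b' := by omega
      rcases lt_trichotomy c c' with h | h | h
      · exact absurd h4.symm (hinj b c c' hc1 h (by omega))
      · exact h ▸ ⟨h2, h3⟩
      · exact absurd h4 (hinj b c' c h1 h hc2)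
  have hin : ∀ {b c r}, b * M ≤ c → c ≤ r → r < (b + 2) * M → W b c ∈ hiddenSet u W M r :=
    fun {b c _} h1 h2 h3 => Or.inr ⟨b, c, h1, h2, h3, rfl⟩
  have hstep : ∀ {b c}, j ≤ b + 1 → b ≤ j + 1 → b * M ≤ c → c + 1 ≤ (b + 2) * M →
      E.Adj (W b c) (W b (c + 1)) := by
    intro b c hb1 hb2 h1 h2
    refine hadj (hinj b c (c + 1) h1 (by omega) h2).symm (fun i hi hmi => ?_) (fun i hi hmi => ?_)
    · obtain ⟨h3, h4⟩ := hmem hb1 hb2 (by omega) h2 i hmi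
      exact hp (t + i) (hi ▸ hin h1 (by omega) h4)
    · obtain ⟨h3, h4⟩ := hmem hb1 hb2 h1 (by omega) i hmi
      rcases h3.eq_or_lt with h5 | h5
      · subst h5
        exact hfresh b (t + i) (by omega) h2 hi
      · exact hp (t + i) (hi ▸ hin (by omega) h5 h4)
  have hchain : ∀ {b c e}, j ≤ b + 1 → b ≤ j + 1 → b * M ≤ c → c ≤ e → e ≤ (b + 2) * M →
      E.Reachable (W b c) (W b e) := by
    intro b c e hb1 hb2 h1 h2
    induction e, h2 using Nat.le_induction with
    | base => intro _; exact SimpleGraph.Reachable.refl _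
    | succ e h2 ih =>
      intro h3
      exact (ih (by omega)).trans (hstep hb1 hb2 (by omega) h3).reachable
  -- The path of a batch ends at a node that is not hidden during the window.
  have hend : ∀ {b e}, j ≤ b + 1 → b ≤ j + 1 → b * M ≤ e → e = min (a + M + 1) ((b + 2) * M) →
      ∀ i : Fin T, W b e ∉ hiddenSet u W M ((t + i) / q) := by
    intro b e hb1 hb2 h1 h2 i hmi
    have h3 := hmem hb1 hb2 h1 (by omega) i hmi
    have h4 := (hround i).2
    omega
  have hjM : (j + 2) * M = (j + 1) * M + M := by ring
  obtain ⟨e₀, he₀⟩ : ∃ e, e = min (a + M + 1) ((j + 2) * M) := ⟨_, rfl⟩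
  have hroot : ∀ x, E.Reachable x (W j e₀) := by
    have hfree₀ : ∀ x, (∀ i : Fin T, x ∉ hiddenSet u W M ((t + i) / q)) →
        E.Reachable x (W j e₀) := fun x hx =>
      hfree hx (hend (by omega) (by omega) (by omega) he₀)
    intro x
    by_cases hx : ∀ i : Fin T, x ∉ hiddenSet u W M ((t + i) / q)
    · exact hfree₀ x hx
    push Not at hx
    obtain ⟨i, hx⟩ := hx
    rcases hx with rfl | ⟨b, c, h1, h2, h3, rfl⟩
    -- `W j a` is hidden in every round of the window, hence not visited there.
    · have h1 : E.Adj x (W j a) := by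
        refine hadj (hWu j a).symm (fun i hi _ => ?_) (fun i hi _ => ?_)
        · exact hp (t + i) (Or.inl hi)
        · have := hround i
          exact hp (t + i) (hi ▸ hin hj1 this.1 (by omega))
      exact h1.reachable.trans (hchain (by omega) (by omega) hj1 (by omega) (by omega))
    · have h4 := hact (hround i).1 (hround i).2 (h1.trans h2) h3
      have h5 := (hround i).2
      exact (hchain h4.1 h4.2 h1 (by omega) (min_le_right _ _)).trans
        (hfree₀ _ (hend h4.1 h4.2 (by omega) rfl))
  have : Nonempty V := ⟨u⟩
  exact ⟨fun x y => (hroot x).trans (hroot y).symm⟩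

/-- The choice of the node `W b c = (b mod 3, chainIndex b c)`: new in its batch, and neither visited
in round `c - 1` nor occupied at time `c * q`, when round `c` begins. The remaining nodes, in the
second summand, are never hidden except `u`. -/
noncomputable def chainIndex {s r : ℕ} [Nonempty (Fin s)] (q M : ℕ)
    (p : ℕ → (Fin 3 × Fin s) ⊕ Fin r) (b c : ℕ) : Fin s :=
  Classical.epsilon fun x => (∀ c', ∀ _ : c' < c, b * M ≤ c' → x ≠ chainIndex q M p b c') ∧
    ∀ t, c * q ≤ t + q → t ≤ c * q → p t ≠ Sum.inl (Fin.ofNat 3 b, x)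
termination_by c

theorem chainIndex_congr {s r : ℕ} [Nonempty (Fin s)] (q M : ℕ)
    {p p' : ℕ → (Fin 3 × Fin s) ⊕ Fin r} (b c : ℕ) (h : ∀ t ≤ c * q, p t = p' t) :
    chainIndex q M p b c = chainIndex q M p' b c := by
  induction c using Nat.strong_induction_on with
  | _ c ih =>
    rw [chainIndex, chainIndex]
    congr 1
    funext x
    refine propext (and_congr (forall₃_congr fun c' hc' _ => ?_) (forall₃_congr fun t _ ht => ?_))
    · rw [ih c' hc' fun t ht => h t (ht.trans (Nat.mul_le_mul_right _ hc'.le))]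
    · rw [h t ht]

/-- A batch excludes at most `2 * M` nodes and a round at most `q + 1`, so the choice is possible. -/
theorem chainIndex_spec {s r : ℕ} [Nonempty (Fin s)] {q M : ℕ} (hs : 2 * M + q + 2 ≤ s)
    (p : ℕ → (Fin 3 × Fin s) ⊕ Fin r) {b c : ℕ} (hc : c ≤ (b + 2) * M) :
    (∀ c' < c, b * M ≤ c' → chainIndex q M p b c ≠ chainIndex q M p b c') ∧
    ∀ t, c * q ≤ t + q → t ≤ c * q → p t ≠ Sum.inl (Fin.ofNat 3 b, chainIndex q M p b c) := by
  classical
  have hex : ∃ x : Fin s, (∀ c', ∀ _ : c' < c, b * M ≤ c' → x ≠ chainIndex q M p b c') ∧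
      ∀ t, c * q ≤ t + q → t ≤ c * q → p t ≠ Sum.inl (Fin.ofNat 3 b, x) := by
    set S : Finset (Fin s) := (Finset.Ico (b * M) c).image (chainIndex q M p b) ∪
      (Finset.Icc (c * q - q) (c * q)).image
        (fun t => Sum.elim Prod.snd (fun _ => Classical.arbitrary _) (p t)) with hS
    have hcard : S.card < Fintype.card (Fin s) := by
      have h1 := Finset.card_union_le ((Finset.Ico (b * M) c).image (chainIndex q M p b))
        ((Finset.Icc (c * q - q) (c * q)).image
          (fun t => Sum.elim Prod.snd (fun _ => Classical.arbitrary _) (p t)))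
      have h2 := Finset.card_image_le (s := Finset.Ico (b * M) c) (f := chainIndex q M p b)
      have h3 := Finset.card_image_le (s := Finset.Icc (c * q - q) (c * q))
        (f := fun t => Sum.elim Prod.snd (fun _ => Classical.arbitrary (Fin s)) (p t))
      rw [Nat.card_Ico] at h2
      rw [Nat.card_Icc] at h3
      rw [Fintype.card_fin, hS]
      rw [add_mul] at hc
      omega
    obtain ⟨x, -, hx⟩ := Finset.exists_mem_notMem_of_card_lt_card (s := S) (t := Finset.univ)
      (by rwa [Finset.card_univ])
    rw [hS, Finset.mem_union, not_or, Finset.mem_image, Finset.mem_image] at hx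
    refine ⟨x, fun c' hc' hb h => hx.1 ⟨c', Finset.mem_Ico.2 ⟨hb, hc'⟩, h.symm⟩,
      fun t h1 h2 h => hx.2 ⟨t, Finset.mem_Icc.2 ⟨by omega, h2⟩, ?_⟩⟩
    rw [h]
    rfl
  have := Classical.epsilon_spec hex
  rw [← chainIndex] at this
  exact this

/-- Windows of `q ^ 2` steps do not suffice on the complete graph with at least `9 * q + 7` nodes. -/
theorem not_explorable_of_le (k : Visibility) {q T s r : ℕ} (hq : 0 < q) (hs : 3 * q + 2 ≤ s)
    (hr : 0 < r) (hT : T ≤ q * q) :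
    ¬ Explorable k (3 * s + r) ((3 * s + r).choose 2) T := by
  classical
  rintro ⟨A, hA⟩
  have : Nonempty (Fin s) := ⟨⟨0, by omega⟩⟩
  obtain ⟨D₀, hD₀⟩ := exists_dynGraph_top ((Fin 3 × Fin s) ⊕ Fin r)
  set u : (Fin 3 × Fin s) ⊕ Fin r := Sum.inr ⟨0, hr⟩ with hu
  set start : (Fin 3 × Fin s) ⊕ Fin r := Sum.inl (0, Classical.arbitrary _) with hstart
  set W : (ℕ → (Fin 3 × Fin s) ⊕ Fin r) → ℕ → ℕ → (Fin 3 × Fin s) ⊕ Fin r :=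
    fun p b c => Sum.inl (Fin.ofNat 3 b, chainIndex q q p b c) with hW
  obtain ⟨D, hDG, hD⟩ := DynGraph.exists_adaptive k A start hD₀
    (fun t p => shownGraph (p t) (hiddenSet u (W p) q (t / q))) (by
      intro t p p' h
      have h1 : hiddenSet u (W p) q (t / q) = hiddenSet u (W p') q (t / q) := by
        ext x
        refine or_congr Iff.rfl (exists₂_congr fun b c => and_congr_right fun _ =>
          and_congr_right fun hc => and_congr_right fun _ => ?_)
        have h2 : W p b c = W p' b c := by
          simp only [hW]
          rw [chainIndex_congr q q b c fun i hi => h i ?_]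
          exact hi.trans ((Nat.mul_le_mul_right _ hc).trans (Nat.div_mul_le_self t q))
        rw [h2]
      rw [h1, h t le_rfl])
  set p := D.position k A start with hpdef
  have hspec := fun b c (hc : c ≤ (b + 2) * q) => chainIndex_spec (M := q) (q := q) (s := s)
    (by omega) p (b := b) (c := c) hc
  have hp : ∀ t, p t ∉ hiddenSet u (W p) q (t / q) := by
    intro t
    induction t with
    | zero =>
      rintro (h | ⟨b, c, h1, h2, h3, h4⟩)
      · exact Sum.inl_ne_inr h
      · rw [Nat.zero_div] at h2
        obtain rfl : c = 0 := by omega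
        exact (hspec b 0 (Nat.zero_le _)).2 0 (by omega) (by omega) h4
    | succ t ih =>
      have h0 : p (t + 1) ∉ hiddenSet u (W p) q (t / q) := by
        rcases D.position_succ k A start t with h | h
        · rw [hpdef, h]; exact ih
        · rw [hD] at h
          exact fun hmem => h.2.1 ⟨rfl, hmem⟩
      rintro (h | ⟨b, c, h1, h2, h3, h4⟩)
      · exact h0 (Or.inl h)
      · have h5 : t / q ≤ (t + 1) / q := Nat.div_le_div_right (Nat.le_succ t)
        by_cases hc : c ≤ t / q
        · exact h0 (Or.inr ⟨b, c, h1, hc, by omega, h4⟩)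
        · have h6 : t + 1 = c * q := by
            have h7 : c * q ≤ t + 1 := (Nat.le_div_iff_mul_le hq).1 h2
            have h8 : t < c * q := (Nat.div_lt_iff_lt_mul hq).1 (by omega)
            omega
          exact (hspec b c (by omega)).2 (t + 1) (by omega) (by omega) h4
  have hconn : D.IntervalConnected T := by
    intro t
    simp only [hD]
    refine connected_iInf_shownGraph hq hq hT hp (fun b c => Sum.inl_ne_inr) ?_ ?_ ?_ t
    · intro b c b' c' h
      have h1 := congrArg Fin.val (Prod.mk.inj (Sum.inl.inj h)).1
      simpa [Fin.ofNat] using h1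
    · intro b c c' h1 h2 h3 h
      exact (hspec b c' h3).1 c h2 h1 (Prod.mk.inj (Sum.inl.inj h)).2
    · intro b t h1 h2
      refine (hspec b (t / q + 1) h2).2 t ?_ ?_
      · have := Nat.div_mul_le_self t q
        rw [add_mul]
        omega
      · have := Nat.lt_mul_div_succ t hq
        rw [mul_comm]
        exact this.le
  have hcard : Nat.card ((Fin 3 × Fin s) ⊕ Fin r) = 3 * s + r := by simp
  have hedge : D.G.edgeSet.ncard = (3 * s + r).choose 2 := by
    rw [hDG, Set.ncard_eq_toFinset_card']
    have := SimpleGraph.card_edgeFinset_top_eq_card_choose_two (V := (Fin 3 × Fin s) ⊕ Fin r)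
    simpa [SimpleGraph.edgeFinset] using this
  obtain ⟨t, c, h1, h2⟩ := hA _ D hcard hedge hconn start u
  exact hp t (Or.inl (by rw [hpdef, D.position_eq k A start h1, h2]))

/-! ### The bounds on `psi` -/

theorem isLeast_psiEdges (k : Visibility) {n : ℕ} (hn : 2 ≤ n) (m : ℕ) :
    IsLeast {T : ℕ | 1 ≤ T ∧ Explorable k n m T} (psiEdges k n m) := by
  have hne : {T : ℕ | 1 ≤ T ∧ Explorable k n m T}.Nonempty :=
    ⟨n ^ 2, Nat.one_le_pow _ _ (by omega), explorable_sq k hn m⟩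
  exact ⟨Nat.sInf_mem hne, fun T hT => Nat.sInf_le hT⟩

theorem le_choose_two {n : ℕ} (hn : 3 ≤ n) : n ≤ n.choose 2 := by
  rw [Nat.choose_two_right, Nat.le_div_iff_mul_le two_pos]
  exact Nat.mul_le_mul_left n (by omega)

theorem psi_le_sq (k : Visibility) {n : ℕ} (hn : 2 ≤ n) : psi k n ≤ n ^ 2 :=
  Finset.sup_le fun m _ => (isLeast_psiEdges k hn m).2
    ⟨Nat.one_le_pow _ _ (by omega), explorable_sq k hn m⟩

theorem sq_le_psi (k : Visibility) {n : ℕ} (hn : 16 ≤ n) : n ^ 2 ≤ 576 * psi k n := by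
  have h1 : psiEdges k n (n.choose 2) ≤ psi k n :=
    Finset.le_sup (Finset.mem_Icc.2 ⟨le_choose_two (by omega), le_rfl⟩)
  set q := (n - 7) / 9 with hq
  obtain ⟨r, hr⟩ : ∃ r, n = 3 * (3 * q + 2) + (r + 1) := ⟨n - (9 * q + 7), by omega⟩
  have h2 : q * q < psiEdges k n (n.choose 2) := by
    by_contra! hle
    have h3 := (isLeast_psiEdges k (n := n) (by omega) (n.choose 2)).1.2
    generalize psiEdges k n (n.choose 2) = T at h3 hle
    rw [hr] at h3
    exact not_explorable_of_le k (by omega) le_rfl r.succ_pos hle h3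
  have h3 : n ≤ 24 * q := by omega
  calc n ^ 2 ≤ (24 * q) ^ 2 := Nat.pow_le_pow_left h3 2
    _ = 576 * (q * q) := by ring
    _ ≤ 576 * psi k n := by omega

end DynExplore

theorem corollary2 (k : DynExplore.Visibility) :
    (∀ n : ℕ, 3 ≤ n → ∀ m : ℕ, m ∈ Finset.Icc n (n.choose 2) →
      IsLeast {T : ℕ | 1 ≤ T ∧ DynExplore.Explorable k n m T} (DynExplore.psiEdges k n m)) ∧
    (∀ n : ℕ, 3 ≤ n →
      IsGreatest (DynExplore.psiEdges k n '' Set.Icc n (n.choose 2)) (DynExplore.psi k n)) ∧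
    (fun n : ℕ => (DynExplore.psi k n : ℝ)) =Θ[atTop] (fun n : ℕ => (n : ℝ) ^ 2) := by
  refine ⟨fun n hn m _ => DynExplore.isLeast_psiEdges k (by omega) m, fun n hn => ⟨?_, ?_⟩, ?_⟩
  · obtain ⟨m, hm, h⟩ := Finset.exists_mem_eq_sup (Finset.Icc n (n.choose 2))
      ⟨n, Finset.mem_Icc.2 ⟨le_rfl, DynExplore.le_choose_two hn⟩⟩ (DynExplore.psiEdges k n)
    exact ⟨m, Finset.mem_Icc.1 hm, h.symm⟩
  · rintro _ ⟨m, hm, rfl⟩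
    exact Finset.le_sup (Finset.mem_Icc.2 hm)
  · constructor
    · refine IsBigO.of_bound 1 ?_
      filter_upwards [eventually_ge_atTop 2] with n hn
      rw [Real.norm_of_nonneg (by positivity), Real.norm_of_nonneg (by positivity), one_mul]
      exact_mod_cast DynExplore.psi_le_sq k hn
    · refine IsBigO.of_bound 576 ?_
      filter_upwards [eventually_ge_atTop 16] with n hn
      rw [Real.norm_of_nonneg (by positivity), Real.norm_of_nonneg (by positivity)]
      exact_mod_cast DynExplore.sq_le_psi k hn
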